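/- Fix a countably infinite set $\mathbb{A}$ of names, on which the group of finite permutations acts. Words are taken over the alphabet $\hat{\mathbb{A}}$ of letters $a$ (free), $[\![a$ (allocating), $a]\!]$ (deallocating), $[\![a]\!]$ (unknown), for $a\in\mathbb{A}$; $\mathrm{db}(w)\in\mathbb{A}^*$ is obtained from $w$ by erasing all brackets. A name is left-open in $w$ if its first occurrence in $w$ carries no opening bracket (is $a$ or $a]\!]$), and right-closed if its last occurrence carries a closing bracket (is $a]\!]$ or $[\![a]\!]$). Write $\mathsf{LO}(w)$ for the set of left-open names of $w$. A word $w$ is right-non-shadowing if for each decomposition $w=uv$ no name is both right-closed in $u$ and left-open in $v$. On right-non-shadowing words, $\equiv_\alpha$ is the least transitive relation such that $\epsilon\equiv_\alpha\epsilon$; $[\![a\,w\equiv_\alpha[\![b\,w'$ if $\langle a\rangle w=\langle b\rangle w'$ (equality in the nominal abstraction set); $\gamma w\equiv_\alpha\gamma w'$ if $w\equiv_\alpha w'$ and $\gamma\in\{a,[\![a\}$; $a]\!]\,w\equiv_\alpha a]\!]\,w'$ if $w\equiv_\alpha w'$ and $a\notin\mathsf{LO}(w)$; and $[\![a]\!]\,w\equiv_\alpha[\![b]\!]\,w'$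 if $w\equiv_\alpha w'$ and $a,b\notin\mathsf{LO}(w)$. A non-deterministic deallocation automaton (NDA) $A=(Q,\Delta,i,F)$ consists of an orbit-finite nominal set $Q$ of states, an equivariant relation $\Delta\subseteq Q\times\hat{\mathbb{A}}\times Q$, an initial state $i\in Q$ and an equivariant set $F\subseteq Q$ of final states such that: (left $\alpha$-invariance) if $\langle a\rangle q'=\langle b\rangle q''$, then $q\xrightarrow{[\![a}q'$ implies $q\xrightarrow{[\![b}q''$, and $q\xrightarrow{[\![a]\!]}q'$ implies $q\xrightarrow{[\![b]\!]}q''$; (name erasure) if $q\xrightarrow{a]\!]}q'$ or $q\xrightarrow{[\![a]\!]}q'$, then $a\notin\mathrm{supp}(q')$; (finite branching) for each $q$ the sets $\{(a,q')\mid q\xrightarrow{a}q'\}$, $\{\langle a\rangle q'\mid q\xrightarrow{[\![a}q'\}$, $\{(a,q')\mid q\xrightarrow{a]\!]}q'\}$ and $\{\langle a\rangle q'\mid q\xrightarrow{[\![a]\!]}q'\}$ are finite. Let $L_0(A)$ be the set of words accepted by $A$ from $i$ in the usual sense, $L_\alpha(A)=\{[w]_\alpha\mid w\in L_0(A)\}$,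 $L_D(A)=\mathrm{db}[L_0(A)]$, and let $\mathcal{D}(L_\alpha(A))=\{\mathrm{db}(w)\mid w\text{ right-non-shadowing},\ [w]_\alpha\in L_\alpha(A)\}$ be the data language of $A$ under local freshness semantics. An RNNA is an NDA without deallocating and unknown transitions. A deterministic deallocation automaton (DDA) is an NDA such that for all $q\in Q$, $\gamma\in\hat{\mathbb{A}}$ there is at most one $q'$ with $q\xrightarrow{\gamma}q'$. **Corollary.** For every RNNA $A$ whose initial state has empty support there exists a DDA $B$ that accepts the same data language: $$L_D(B)=\mathcal{D}(L_\alpha(B))=\mathcal{D}(L_\alpha(A)).$$ -/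

import Mathlib

universe u v

/-! ### Nominal sets -/

/-- The group of finite permutations of the set `𝔸` of names. -/
def FinPerm (𝔸 : Type u) : Subgroup (Equiv.Perm 𝔸) where
  carrier := {π | {a | π a ≠ a}.Finite}
  one_mem' := by simp
  mul_mem' := by
    intro π ρ hπ hρ
    refine (Set.Finite.union hπ hρ).subset ?_
    intro a ha
    by_contra h
    simp only [Set.mem_union, Set.mem_ofPred_eq, not_or, not_not] at h
    exact ha (by rw [Equiv.Perm.mul_apply, h.2, h.1])
  inv_mem' := by
    intro π hπ
    refine Set.Finite.subset hπ ?_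
    intro a ha h
    exact ha (by rw [Equiv.Perm.inv_eq_iff_eq]; exact h.symm)

open Classical in
/-- The transposition `(a b)`, as a finite permutation. -/
noncomputable def FinPerm.swap {𝔸 : Type u} (a b : 𝔸) : FinPerm 𝔸 :=
  ⟨Equiv.swap a b, by
    refine (Set.toFinite {a, b}).subset ?_
    intro c hc
    by_contra h
    simp only [Set.mem_insert_iff, Set.mem_singleton_iff, not_or] at h
    exact hc (Equiv.swap_apply_of_ne_of_ne h.1 h.2)⟩

/-- An action of the finite permutations on `X` makes `X` a nominal set if every element has a
finite support. -/
def IsNominal (𝔸 : Type u) (X : Type v) [MulAction (FinPerm 𝔸) X] : Prop :=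
  ∀ x : X, ∃ S : Set 𝔸, S.Finite ∧ MulAction.Supports (FinPerm 𝔸) S x

/-- A set with an action of the finite permutations is orbit-finite if it has finitely many
orbits. -/
def IsOrbitFinite (𝔸 : Type u) (X : Type v) [MulAction (FinPerm 𝔸) X] : Prop :=
  Finite (MulAction.orbitRel.Quotient (FinPerm 𝔸) X)

/-- The support of an element of a nominal set: the least finite support, that is, the
intersection of all finite supports. -/
def supp (𝔸 : Type u) {X : Type v} [MulAction (FinPerm 𝔸) X] (x : X) : Set 𝔸 :=
  {a | ∀ S : Set 𝔸, S.Finite → MulAction.Supports (FinPerm 𝔸) S x → a ∈ S}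

/-- The relation `(a, x) ∼ (b, y)` on `𝔸 × X`: `(a c) • x = (b c) • y` for some name `c` fresh for
`a`, `b`, `x`, `y`. -/
def AbsRel (𝔸 : Type u) (X : Type v) [MulAction (FinPerm 𝔸) X] (p q : 𝔸 × X) : Prop :=
  ∃ c : 𝔸, c ≠ p.1 ∧ c ≠ q.1 ∧ c ∉ supp 𝔸 p.2 ∧ c ∉ supp 𝔸 q.2 ∧
    FinPerm.swap p.1 c • p.2 = FinPerm.swap q.1 c • q.2

/-- The abstraction set `[𝔸]X = (𝔸 × X) / ∼`. -/
def Abstraction (𝔸 : Type u) (X : Type v) [MulAction (FinPerm 𝔸) X] : Type (max u v) :=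
  Quot (AbsRel 𝔸 X)

/-- The element `⟨a⟩x` of the abstraction set. -/
def abst {𝔸 : Type u} {X : Type v} [MulAction (FinPerm 𝔸) X] (a : 𝔸) (x : X) : Abstraction 𝔸 X :=
  Quot.mk _ (a, x)

/-! ### Words with explicit allocation and deallocation -/

/-- The alphabet of letters over the names `𝔸`. -/
inductive Letter (𝔸 : Type u) : Type u
  /-- The plain letter `a`. -/
  | free (a : 𝔸) : Letter 𝔸
  /-- The letter `⟦a`, allocating `a`. -/
  | alloc (a : 𝔸) : Letter 𝔸
  /-- The letter `a⟧`, deallocating `a`. -/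
  | dealloc (a : 𝔸) : Letter 𝔸
  /-- The letter `⟦a⟧`, allocating and immediately deallocating `a`. -/
  | unknown (a : 𝔸) : Letter 𝔸

namespace Letter

variable {𝔸 : Type u}

/-- The underlying name of a letter. -/
def name : Letter 𝔸 → 𝔸
  | free a => a
  | alloc a => a
  | dealloc a => a
  | unknown a => a

/-- Renaming of a letter. -/
def map (f : 𝔸 → 𝔸) : Letter 𝔸 → Letter 𝔸
  | free a => free (f a)
  | alloc a => alloc (f a)
  | dealloc a => dealloc (f a)
  | unknown a => unknown (f a)

instance : MulAction (FinPerm 𝔸) (Letter 𝔸) where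
  smul π γ := γ.map (fun a => π • a)
  one_smul γ := by cases γ <;> rfl
  mul_smul π ρ γ := by cases γ <;> rfl

end Letter

/-- Words over the alphabet of letters. -/
abbrev DWord (𝔸 : Type u) : Type u := List (Letter 𝔸)

namespace DWord

variable {𝔸 : Type u}

/-- Finite permutations act on words letter by letter. -/
instance : MulAction (FinPerm 𝔸) (DWord 𝔸) where
  smul π w := w.map (fun γ => π • γ)
  one_smul w := by
    change List.map _ w = w
    simp
  mul_smul π ρ w := by
    change List.map _ w = List.map _ (List.map _ w)
    simp [mul_smul, Function.comp_def]

/-- The left-open names of a word: those whose first occurrence is without binder. -/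
def lo : DWord 𝔸 → Set 𝔸
  | [] => ∅
  | .free a :: w => lo w ∪ {a}
  | .alloc a :: w => lo w \ {a}
  | .dealloc a :: w => lo w ∪ {a}
  | .unknown a :: w => lo w \ {a}

/-- The left-closed names of a word: those whose first occurrence is with binder. -/
def lc : DWord 𝔸 → Set 𝔸
  | [] => ∅
  | .free a :: w => lc w \ {a}
  | .alloc a :: w => lc w ∪ {a}
  | .dealloc a :: w => lc w \ {a}
  | .unknown a :: w => lc w ∪ {a}

/-- The right-closed names of a word: those whose last occurrence is with the closing marker. -/
def rc : DWord 𝔸 → Set 𝔸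
  | [] => ∅
  | .free _ :: w => rc w
  | .alloc _ :: w => rc w
  | .dealloc a :: w => rc w ∪ ({a} \ (lc w ∪ lo w))
  | .unknown a :: w => rc w ∪ ({a} \ (lc w ∪ lo w))

/-- Right-non-shadowing words. -/
def RNS (w : DWord 𝔸) : Prop :=
  ∀ x y : DWord 𝔸, w = x ++ y → rc x ∩ lo y = ∅

/-- `α`-equivalence of right-non-shadowing words. -/
inductive AlphaEquiv : DWord 𝔸 → DWord 𝔸 → Prop
  | nil : AlphaEquiv [] []
  | bind (a b : 𝔸) (w w' : DWord 𝔸) :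
      RNS (.alloc a :: w) → RNS (.alloc b :: w') → abst a w = abst b w' →
      AlphaEquiv (.alloc a :: w) (.alloc b :: w')
  | congr_free (a : 𝔸) (w w' : DWord 𝔸) :
      AlphaEquiv w w' → AlphaEquiv (.free a :: w) (.free a :: w')
  | congr_alloc (a : 𝔸) (w w' : DWord 𝔸) :
      AlphaEquiv w w' → AlphaEquiv (.alloc a :: w) (.alloc a :: w')
  | congr_dealloc (a : 𝔸) (w w' : DWord 𝔸) :
      AlphaEquiv w w' → a ∉ lo w → AlphaEquiv (.dealloc a :: w) (.dealloc a :: w')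
  | congr_unknown (a b : 𝔸) (w w' : DWord 𝔸) :
      AlphaEquiv w w' → {a, b} ∩ lo w = ∅ → AlphaEquiv (.unknown a :: w) (.unknown b :: w')
  | trans (w₁ w₂ w₃ : DWord 𝔸) : AlphaEquiv w₁ w₂ → AlphaEquiv w₂ w₃ → AlphaEquiv w₁ w₃

/-- The `α`-equivalence class of a right-non-shadowing word, as a set of words. -/
def alphaClass (w : DWord 𝔸) : Set (DWord 𝔸) := {w' | AlphaEquiv w w'}

/-- The data word underlying a word: all binders and markers are erased. -/
def db (w : DWord 𝔸) : List 𝔸 := w.map Letter.name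

end DWord

/-- The local freshness semantics of a set of `α`-equivalence classes: the data words underlying
the right-non-shadowing representatives of these classes. -/
def localFreshness {𝔸 : Type u} (L : Set (Set (DWord 𝔸))) : Set (List 𝔸) :=
  DWord.db '' {w | DWord.RNS w ∧ DWord.alphaClass w ∈ L}

/-! ### Deallocation automata -/

/-- Non-deterministic deallocation automata over the names `𝔸`. -/
structure NDA (𝔸 : Type u) where
  /-- The set of states, an orbit-finite nominal set. -/
  State : Type v
  [action : MulAction (FinPerm 𝔸) State]
  nominal : IsNominal 𝔸 State
  orbitFinite : IsOrbitFinite 𝔸 State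
  /-- The transition relation. -/
  trans : State → Letter 𝔸 → State → Prop
  /-- The initial state. -/
  init : State
  /-- The set of final states. -/
  final : Set State
  trans_equivariant : ∀ (π : FinPerm 𝔸) (q q' : State) (γ : Letter 𝔸),
    trans q γ q' → trans (π • q) (π • γ) (π • q')
  final_equivariant : ∀ (π : FinPerm 𝔸) (q : State), q ∈ final → π • q ∈ final
  /-- Left `α`-invariance. -/
  left_invariant_alloc : ∀ (q q' q'' : State) (a b : 𝔸), abst a q' = abst b q'' →
    trans q (.alloc a) q' → trans q (.alloc b) q''
  left_invariant_unknown : ∀ (q q' q'' : State) (a b : 𝔸), abst a q' = abst b q'' →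
    trans q (.unknown a) q' → trans q (.unknown b) q''
  /-- Name erasure. -/
  erasure_dealloc : ∀ (q q' : State) (a : 𝔸), trans q (.dealloc a) q' → a ∉ supp 𝔸 q'
  erasure_unknown : ∀ (q q' : State) (a : 𝔸), trans q (.unknown a) q' → a ∉ supp 𝔸 q'
  /-- Finite branching, up to left `α`-invariance. -/
  finite_free : ∀ q : State, {p : 𝔸 × State | trans q (.free p.1) p.2}.Finite
  finite_alloc : ∀ q : State,
    {x : Abstraction 𝔸 State | ∃ a q', trans q (.alloc a) q' ∧ x = abst a q'}.Finite
  finite_dealloc : ∀ q : State, {p : 𝔸 × State | trans q (.dealloc p.1) p.2}.Finite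
  finite_unknown : ∀ q : State,
    {x : Abstraction 𝔸 State | ∃ a q', trans q (.unknown a) q' ∧ x = abst a q'}.Finite

attribute [instance] NDA.action

namespace NDA

variable {𝔸 : Type u}

/-- A state accepts a word if there is a run on it that ends in a final state. -/
def Accepts (A : NDA.{u, v} 𝔸) : A.State → DWord 𝔸 → Prop
  | q, [] => q ∈ A.final
  | q, γ :: w => ∃ q' : A.State, A.trans q γ q' ∧ A.Accepts q' w

/-- The literal language `L₀(A)`. -/
def literalLanguage (A : NDA.{u, v} 𝔸) : Set (DWord 𝔸) := {w | A.Accepts A.init w}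

/-- The alphatic language `L_α(A)`. -/
def alphaticLanguage (A : NDA.{u, v} 𝔸) : Set (Set (DWord 𝔸)) :=
  DWord.alphaClass '' A.literalLanguage

/-- The set `L_D(A)` of data words underlying the literally accepted words. -/
def dataLanguage (A : NDA.{u, v} 𝔸) : Set (List 𝔸) := DWord.db '' A.literalLanguage

/-- An RNNA is an NDA without deallocating and unknown transitions. -/
def IsRNNA (A : NDA.{u, v} 𝔸) : Prop :=
  ∀ (q q' : A.State) (a : 𝔸), ¬ A.trans q (.dealloc a) q' ∧ ¬ A.trans q (.unknown a) q'

/-- A deterministic deallocation automaton (DDA) is an NDA whose transition relation is (partially)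
deterministic. -/
def IsDDA (A : NDA.{u, v} 𝔸) : Prop :=
  ∀ (q q' q'' : A.State) (γ : Letter 𝔸), A.trans q γ q' → A.trans q γ q'' → q' = q''

end NDA

/-!
The automaton `B` is a power set construction made deterministic by the deallocation markers. A data
word belongs to the local freshness semantics of `A` if `A` has a run on it in which a stored name
may be overwritten as soon as it is not read again. Guessing which names will be read again is the
source of nondeterminism that no power set construction on the data words themselves could remove,
since the subsets would have unbounded support. With markers placed at the last use of every name
(`DWord.markClose`), the letters determine the set `N` of live names, those stored now and read
later: it is the set of left-open names of the remaining word. Hence a state of `B`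
(`NDA.LiveSet`) is a set `N` of live names together with a set of states of `A` that is closed under
all permutations fixing `N`, which expresses that the other names are forgotten.

These states form an orbit-finite nominal set (`NDA.LiveSet.isOrbitFinite`): a state of `A` accepts
only words whose left-open names lie in its support (`NDA.IsRNNA.lo_subset_supp`), so the size of
`N` can be bounded by the largest support of a state of `A`; and an orbit-finite nominal set has only
finitely many orbits under the permutations fixing a finite set of names
(`exists_finite_classifier`). Since the support of a state of `B` is `N`, left `α`-invariance and
name erasure are immediate.

For the languages, the key fact is that the `α`-equivalence class of a right-non-shadowing word is
unchanged by permutations fixing its left-open names (`DWord.RNS.alphaEquiv_smul`). It yields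
soundness (`NDA.exists_accepts_alphaEquiv_dropClose`), where states are known only up to such
permutations, and shows that placing markers respects `α`-equivalence
(`DWord.AlphaEquiv.markClose`). Completeness is `NDA.accepts_markClose`: here the empty support of
the initial state is used, as it makes every name of an accepted word allocated. Finally the literal
language of `B` is itself closed under `α`-equivalence (`NDA.Accepts.of_alphaEquiv`), so that its
literal and its local freshness semantics coincide.
-/

section
open MulAction

/-! ### Transpositions and supports -/

namespace FinPerm

variable {𝔸 : Type u} {X : Type v} [MulAction (FinPerm 𝔸) X]

@[ext] theorem ext_name {π ρ : FinPerm 𝔸} (h : ∀ a : 𝔸, π • a = ρ • a) : π = ρ :=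
  Subtype.ext (Equiv.ext h)

@[simp] theorem swap_smul_left (a b : 𝔸) : swap a b • a = b := by
  classical exact Equiv.swap_apply_left a b

@[simp] theorem swap_smul_right (a b : 𝔸) : swap a b • b = a := by
  classical exact Equiv.swap_apply_right a b

theorem swap_smul_of_ne {a b c : 𝔸} (ha : c ≠ a) (hb : c ≠ b) : swap a b • c = c := by
  classical exact Equiv.swap_apply_of_ne_of_ne ha hb

@[simp] theorem swap_self (a : 𝔸) : swap a a = 1 := by
  classical exact Subtype.ext (Equiv.swap_self a)

theorem swap_comm (a b : 𝔸) : swap a b = swap b a := by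
  classical exact Subtype.ext (Equiv.swap_comm a b)

@[simp] theorem swap_mul_self (a b : 𝔸) : swap a b * swap a b = 1 := by
  classical exact Subtype.ext (Equiv.swap_mul_self a b)

@[simp] theorem swap_smul_swap_smul (a b : 𝔸) (x : X) : swap a b • swap a b • x = x := by
  rw [smul_smul, swap_mul_self, one_smul]

theorem mul_swap (π : FinPerm 𝔸) (a b : 𝔸) : π * swap a b = swap (π • a) (π • b) * π := by
  classical exact Subtype.ext (Equiv.mul_swap_eq_swap_mul (π : Equiv.Perm 𝔸) a b)

theorem smul_swap_smul (π : FinPerm 𝔸) (a b : 𝔸) (x : X) :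
    π • swap a b • x = swap (π • a) (π • b) • π • x := by
  rw [smul_smul, mul_swap, mul_smul]

theorem finite_moved (π : FinPerm 𝔸) : {a : 𝔸 | π • a ≠ a}.Finite := π.2

/-- Every finite permutation that fixes `S` pointwise is a product of transpositions of names
outside `S`, so transpositions suffice to test whether `S` supports `x`. -/
theorem supports_of_swap {S : Set 𝔸} {x : X} (h : ∀ a ∉ S, ∀ b ∉ S, swap a b • x = x) :
    Supports (FinPerm 𝔸) S x := by
  suffices H : ∀ (n : ℕ) (π : FinPerm 𝔸), {a : 𝔸 | π • a ≠ a}.ncard ≤ n →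
      (∀ a ∈ S, π • a = a) → π • x = x from fun π hπ => H _ π le_rfl fun a ha => hπ ha
  intro n
  induction n with
  | zero =>
    intro π hn _
    have h0 := (Set.ncard_eq_zero (finite_moved π)).1 (Nat.le_zero.1 hn)
    have : π = 1 := by
      ext a
      by_contra hne
      have : a ∈ {a : 𝔸 | π • a ≠ a} := by simpa using hne
      simp [h0] at this
    simp [this]
  | succ n ih =>
    intro π hn hS
    by_cases h1 : ∃ a : 𝔸, π • a ≠ a
    · obtain ⟨a, ha⟩ := h1
      have haS : a ∉ S := fun h => ha (hS a h)
      have hπa : π • a ∉ S := fun h => ha (smul_left_cancel π (hS _ h))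
      -- `(a (π a)) * π` fixes `a` and moves nothing that `π` does not move
      have hlt : {b : 𝔸 | (swap a (π • a) * π) • b ≠ b}.ncard < {b : 𝔸 | π • b ≠ b}.ncard := by
        refine Set.ncard_lt_ncard ⟨?_, fun hsub => ?_⟩ (finite_moved π)
        · intro b hb hfix
          simp only [Set.mem_ofPred_eq, mul_smul] at hb
          apply hb
          rw [hfix]
          refine swap_smul_of_ne ?_ ?_
          · rintro rfl; exact ha hfix
          · intro hba
            rw [← hfix] at hba
            have := smul_left_cancel π hba
            subst this; exact ha hfix
        · have := hsub (show a ∈ {b : 𝔸 | π • b ≠ b} from ha)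
          simp [mul_smul] at this
      have := ih (swap a (π • a) * π) (by omega) (by
        intro b hb
        rw [mul_smul, hS b hb]
        refine swap_smul_of_ne ?_ ?_
        · rintro rfl; exact haS hb
        · rintro rfl; exact hπa hb)
      rw [mul_smul] at this
      have h2 := congrArg (swap a (π • a) • ·) this
      simp only [swap_smul_swap_smul] at h2
      rw [h2, h a haS _ hπa]
    · have : π = 1 := by
        ext a
        by_contra hne
        exact h1 ⟨a, by simpa using hne⟩
      simp [this]

/-- A partial injection with finite domain, presented as `f i ↦ g i`, extends to a finite
permutation. -/
theorem exists_smul_eq {ι : Type*} [Finite ι] (f g : ι → 𝔸)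
    (h : ∀ i j, f i = f j ↔ g i = g j) : ∃ π : FinPerm 𝔸, ∀ i, π • f i = g i := by
  classical
  have := Fintype.ofFinite ι
  suffices H : ∀ s : Finset ι, ∃ π : FinPerm 𝔸, ∀ i ∈ s, π • f i = g i by
    obtain ⟨π, hπ⟩ := H Finset.univ
    exact ⟨π, fun i => hπ i (Finset.mem_univ i)⟩
  intro s
  induction s using Finset.induction_on with
  | empty => exact ⟨1, by simp⟩
  | insert i s _ ih =>
    obtain ⟨π, hπ⟩ := ih
    by_cases hi : ∃ j ∈ s, f i = f j
    · obtain ⟨j, hj, hij⟩ := hi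
      refine ⟨π, fun k hk => ?_⟩
      rcases Finset.mem_insert.1 hk with rfl | hk
      · rw [hij, hπ j hj, (h _ _).1 hij]
      · exact hπ k hk
    · push Not at hi
      refine ⟨swap (π • f i) (g i) * π, fun k hk => ?_⟩
      rcases Finset.mem_insert.1 hk with rfl | hk
      · simp [mul_smul]
      · rw [mul_smul, hπ k hk]
        refine swap_smul_of_ne (fun e => ?_) (fun e => ?_)
        · rw [← hπ k hk] at e
          exact hi k hk (smul_left_cancel π e).symm
        · exact hi k hk ((h _ _).2 e.symm)

end FinPerm

open FinPerm

section Supp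

variable {𝔸 : Type u} {X : Type v} [MulAction (FinPerm 𝔸) X]

theorem exists_fresh [Infinite 𝔸] {S : Set 𝔸} (hS : S.Finite) : ∃ c, c ∉ S :=
  hS.infinite_compl.nonempty

theorem supp_subset {S : Set 𝔸} {x : X} (hS : S.Finite) (h : Supports (FinPerm 𝔸) S x) :
    supp 𝔸 x ⊆ S := fun _ ha => ha S hS h

theorem supports_swap {S : Set 𝔸} {x : X} (h : Supports (FinPerm 𝔸) S x) {a b : 𝔸} (ha : a ∉ S)
    (hb : b ∉ S) : swap a b • x = x :=
  h _ fun c hc => swap_smul_of_ne (by rintro rfl; exact ha hc) (by rintro rfl; exact hb hc)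

theorem swap_smul_of_notMem_supp [Infinite 𝔸] {x : X} {a b : 𝔸} (ha : a ∉ supp 𝔸 x)
    (hb : b ∉ supp 𝔸 x) : swap a b • x = x := by
  simp only [supp, Set.mem_ofPred_eq, not_forall] at ha hb
  obtain ⟨S, hSf, hS, haS⟩ := ha
  obtain ⟨T, hTf, hT, hbT⟩ := hb
  by_cases hab : a = b
  · simp [hab]
  obtain ⟨c, hc⟩ := exists_fresh ((hSf.union hTf).union (Set.toFinite {a, b}))
  simp only [Set.mem_union, Set.mem_insert_iff, Set.mem_singleton_iff, not_or] at hc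
  obtain ⟨⟨hcS, hcT⟩, hca, hcb⟩ := hc
  -- `(a b) = (a c) (b c) (a c)` with `c` outside both supports
  have h1 := supports_swap hS haS hcS
  have h2 := supports_swap hT hbT hcT
  have h3 := smul_swap_smul (swap a c) b c x
  rw [h2, h1, swap_smul_right, swap_smul_of_ne (Ne.symm hab) (Ne.symm hcb), swap_comm] at h3
  exact h3.symm

/-- The least support is a support. -/
theorem supports_supp [Infinite 𝔸] (x : X) : Supports (FinPerm 𝔸) (supp 𝔸 x) x :=
  supports_of_swap fun _ ha _ hb => swap_smul_of_notMem_supp ha hb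

theorem IsNominal.finite_supp (hX : IsNominal 𝔸 X) (x : X) : (supp 𝔸 x).Finite := by
  obtain ⟨S, hS, h⟩ := hX x
  exact hS.subset (supp_subset hS h)

theorem Supports.smul_finPerm {S : Set 𝔸} {x : X} (h : Supports (FinPerm 𝔸) S x) (π : FinPerm 𝔸) :
    Supports (FinPerm 𝔸) ((π • · ) '' S) (π • x) := by
  intro ρ hρ
  have := h (π⁻¹ * ρ * π) fun a ha => by
    have := hρ (Set.mem_image_of_mem (π • ·) ha)
    rw [mul_smul, mul_smul, this, inv_smul_smul]
  rw [mul_smul, mul_smul, inv_smul_eq_iff] at this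
  exact this

theorem smul_mem_supp {π : FinPerm 𝔸} {x : X} {a : 𝔸} (h : a ∈ supp 𝔸 x) :
    π • a ∈ supp 𝔸 (π • x) := by
  intro S hS hsup
  have h1 := Supports.smul_finPerm hsup π⁻¹
  rw [inv_smul_smul] at h1
  obtain ⟨b, hb, hba⟩ := h _ (hS.image _) h1
  simp only at hba
  rwa [← hba, smul_inv_smul]

theorem smul_mem_supp_iff {π : FinPerm 𝔸} {x : X} {a : 𝔸} :
    π • a ∈ supp 𝔸 (π • x) ↔ a ∈ supp 𝔸 x := by
  refine ⟨fun h => ?_, smul_mem_supp⟩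
  simpa using smul_mem_supp (π := π⁻¹) h

theorem supp_smul (π : FinPerm 𝔸) (x : X) : supp 𝔸 (π • x) = (π • ·) '' supp 𝔸 x := by
  ext a
  rw [← smul_inv_smul π a, smul_mem_supp_iff]
  constructor
  · intro h; exact ⟨_, h, rfl⟩
  · rintro ⟨b, hb, h⟩
    rwa [← smul_left_cancel π h]

theorem mem_supp_swap_iff {a b c : 𝔸} {x : X} :
    c ∈ supp 𝔸 (swap a b • x) ↔ swap a b • c ∈ supp 𝔸 x := by
  rw [← smul_mem_supp_iff (π := swap a b) (x := x), swap_smul_swap_smul]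

/-- Moving a name `a` of the support of `x` to a fresh name `c` yields a different element for
each `c`. -/
theorem swap_smul_injOn [Infinite 𝔸] {x : X} {a : 𝔸} (ha : a ∈ supp 𝔸 x) :
    Set.InjOn (fun c => swap a c • x) (supp 𝔸 x)ᶜ := by
  intro c hc d hd h
  simp only at h
  by_contra hne
  have h1 : c ∈ supp 𝔸 (swap a c • x) := by
    rw [mem_supp_swap_iff, swap_smul_right]; exact ha
  rw [h, mem_supp_swap_iff, swap_smul_of_ne (by rintro rfl; exact hc ha) hne] at h1
  exact hc h1

/-- An equivariant assignment of finite sets of names stays within the support. -/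
theorem subset_supp_of_equivariant [Infinite 𝔸]
    (f : X → Set 𝔸) (hf : ∀ (π : FinPerm 𝔸) (x : X) (a : 𝔸), a ∈ f x → π • a ∈ f (π • x))
    {x : X} (hfin : (f x).Finite) : f x ⊆ supp 𝔸 x := by
  intro a ha S hS hsup
  by_contra haS
  obtain ⟨c, hc⟩ := exists_fresh (hS.union hfin)
  rw [Set.mem_union, not_or] at hc
  have := hf (swap a c) x a ha
  rw [supports_swap hsup haS hc.1, swap_smul_left] at this
  exact hc.2 this

/-! ### Abstraction sets -/

/-- The explicit description of equality in the abstraction set: either nothing is renamed, or the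
new bound name is fresh for the body. -/
theorem abst_eq_iff [Infinite 𝔸] (hX : IsNominal 𝔸 X) {a b : 𝔸} {x y : X} :
    abst a x = abst b y ↔ y = swap a b • x ∧ (b = a ∨ b ∉ supp 𝔸 x) := by
  constructor
  · intro h
    have h' := Quot.eqvGen_exact h
    suffices H : ∀ p q : 𝔸 × X, Relation.EqvGen (AbsRel 𝔸 X) p q →
        q.2 = swap p.1 q.1 • p.2 ∧ (q.1 = p.1 ∨ q.1 ∉ supp 𝔸 p.2) from H _ _ h'
    clear h h'
    intro p q h
    induction h with
    | rel p q h =>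
      obtain ⟨⟨a, x⟩, ⟨b, y⟩⟩ := p, q
      obtain ⟨c, hca, hcb, hcx, hcy, h⟩ := h
      simp only at hca hcb hcx hcy h ⊢
      by_cases hab : b = a
      · subst hab
        simpa using (smul_left_cancel _ h).symm
      have hbx : b ∉ supp 𝔸 x := by
        have h1 : b ∉ supp 𝔸 (swap b c • y) := by
          rwa [mem_supp_swap_iff, swap_smul_left]
        rwa [← h, mem_supp_swap_iff, swap_smul_of_ne hab (Ne.symm hcb)] at h1
      refine ⟨?_, Or.inr hbx⟩
      have h1 := congrArg (swap b c • ·) h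
      simp only [swap_smul_swap_smul] at h1
      rw [← h1, smul_swap_smul, swap_smul_of_ne (Ne.symm hab) (Ne.symm hca), swap_smul_right,
        swap_smul_of_notMem_supp hbx hcx]
    | refl p => simp
    | symm p q _ ih =>
      obtain ⟨⟨a, x⟩, ⟨b, y⟩⟩ := p, q
      simp only at ih ⊢
      obtain ⟨rfl, ih⟩ := ih
      refine ⟨by rw [swap_comm b a, swap_smul_swap_smul], ?_⟩
      rcases ih with rfl | ih
      · exact Or.inl rfl
      · right; rwa [mem_supp_swap_iff, swap_smul_left]
    | trans p q r _ _ ih₁ ih₂ =>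
      obtain ⟨⟨a, x⟩, ⟨b, y⟩, ⟨c, z⟩⟩ := p, q, r
      simp only at ih₁ ih₂ ⊢
      obtain ⟨rfl, h1⟩ := ih₁
      obtain ⟨rfl, h2⟩ := ih₂
      by_cases hba : b = a
      · subst hba
        simpa using h2
      by_cases hcb : c = b
      · subst hcb
        simpa using h1
      have h1 := h1.resolve_left hba
      have h2 := h2.resolve_left hcb
      by_cases hca : c = a
      · subst hca
        exact ⟨by rw [swap_comm b c]; simp, Or.inl rfl⟩
      rw [mem_supp_swap_iff, swap_smul_of_ne hca hcb] at h2
      refine ⟨?_, Or.inr h2⟩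
      rw [smul_swap_smul, swap_smul_of_ne (Ne.symm hba) (Ne.symm hca), swap_smul_left,
        swap_smul_of_notMem_supp h1 h2]
  · rintro ⟨rfl, h⟩
    by_cases hba : b = a
    · subst hba; simp
    have hb := h.resolve_left hba
    obtain ⟨c, hc⟩ := exists_fresh
      (((hX.finite_supp x).union (hX.finite_supp (swap a b • x))).union (Set.toFinite {a, b}))
    simp only [Set.mem_union, Set.mem_insert_iff, Set.mem_singleton_iff, not_or] at hc
    obtain ⟨⟨hcx, hcy⟩, hca, hcb⟩ := hc
    refine Quot.sound ⟨c, hca, hcb, hcx, hcy, ?_⟩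
    simp only
    rw [smul_swap_smul (swap b c), swap_smul_of_ne (Ne.symm hba) (Ne.symm hca), swap_smul_left,
      swap_smul_of_notMem_supp hb hcx]

theorem abst_injective [Infinite 𝔸] (hX : IsNominal 𝔸 X) {a : 𝔸} {x y : X}
    (h : abst a x = abst a y) : x = y := by
  simpa using ((abst_eq_iff hX).1 h).1.symm

end Supp

/-! ### Orbits under pointwise stabilizers -/

section Orbits

variable {𝔸 : Type u} {X : Type v} [MulAction (FinPerm 𝔸) X]

theorem exists_ncard_supp_le (hX : IsOrbitFinite 𝔸 X) :
    ∃ k : ℕ, ∀ x : X, (supp 𝔸 x).ncard ≤ k := by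
  have : Finite (orbitRel.Quotient (FinPerm 𝔸) X) := hX
  obtain ⟨k, hk⟩ := (Set.finite_range fun o : orbitRel.Quotient (FinPerm 𝔸) X =>
    (supp 𝔸 o.out).ncard).bddAbove
  refine ⟨k, fun x => ?_⟩
  have h := Quotient.mk_out (s := orbitRel (FinPerm 𝔸) X) x
  obtain ⟨π, hπ⟩ := h
  have h2 := hk (Set.mem_range_self (Quotient.mk (orbitRel (FinPerm 𝔸) X) x))
  beta_reduce at h2 hπ
  rw [← hπ, supp_smul, Set.ncard_image_of_injective _ (MulAction.injective π)] at h2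
  exact h2

/-- An orbit-finite nominal set has only finitely many orbits under the pointwise stabilizer of a
finite set `N` of names: the orbit of `π • o` is determined by the orbit representative `o` and by
which names of the support of `o` are mapped by `π` to which names of `N`. -/
theorem exists_finite_classifier [Infinite 𝔸] (hX : IsNominal 𝔸 X) (hO : IsOrbitFinite 𝔸 X)
    {N : Set 𝔸} (hN : N.Finite) :
    ∃ (T : Type (max u v)) (_ : Finite T) (t : X → T), ∀ x y, t x = t y →
      ∃ π : FinPerm 𝔸, (∀ a ∈ N, π • a = a) ∧ π • x = y := by
  classical
  have : Finite (orbitRel.Quotient (FinPerm 𝔸) X) := hO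
  have (x : X) : Finite (supp 𝔸 x) := hX.finite_supp x
  have : Finite N := hN
  have hout : ∀ x : X, ∃ π : FinPerm 𝔸,
      π • (Quotient.mk (orbitRel (FinPerm 𝔸) X) x).out = x := by
    intro x
    obtain ⟨π, hπ⟩ := Quotient.mk_out (s := orbitRel (FinPerm 𝔸) X) x
    beta_reduce at hπ
    exact ⟨π⁻¹, by rw [← hπ, inv_smul_smul]⟩
  choose p hp using hout
  refine ⟨Σ o : orbitRel.Quotient (FinPerm 𝔸) X, (supp 𝔸 o.out → Option N), inferInstance,
    fun x => ⟨Quotient.mk (orbitRel (FinPerm 𝔸) X) x,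
      fun s => if h : p x • (s : 𝔸) ∈ N then some ⟨_, h⟩ else none⟩, ?_⟩
  intro x y hxy
  obtain ⟨o, ho, ρx, ρy, hx, hy, hs⟩ : ∃ o : X, (supp 𝔸 o).Finite ∧ ∃ ρx ρy : FinPerm 𝔸,
      ρx • o = x ∧ ρy • o = y ∧ ∀ s ∈ supp 𝔸 o,
      (if h : ρx • s ∈ N then some (⟨_, h⟩ : N) else none) =
        (if h : ρy • s ∈ N then some (⟨_, h⟩ : N) else none) := by
    have hx := hp x
    have hy := hp y
    beta_reduce at hxy
    revert hxy hx hy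
    generalize p x = ρx
    generalize p y = ρy
    generalize Quotient.mk (orbitRel (FinPerm 𝔸) X) x = o
    generalize Quotient.mk (orbitRel (FinPerm 𝔸) X) y = o'
    intro hxy hx hy
    obtain ⟨rfl, h2⟩ := Sigma.mk.inj_iff.1 hxy
    refine ⟨o.out, hX.finite_supp _, ρx, ρy, hx, hy, fun s hs => ?_⟩
    exact congrFun (eq_of_heq h2) ⟨s, hs⟩
  have : Finite (supp 𝔸 o) := ho
  obtain ⟨π, hπ⟩ := exists_smul_eq (ι := N ⊕ supp 𝔸 o)
    (Sum.elim (fun a => (a : 𝔸)) fun s => ρx • (s : 𝔸))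
    (Sum.elim (fun a => (a : 𝔸)) fun s => ρy • (s : 𝔸)) (by
      have key : ∀ a ∈ N, ∀ s ∈ supp 𝔸 o, (a = ρx • s ↔ a = ρy • s) := by
        intro a ha s hs'
        have := hs s hs'
        constructor
        · rintro rfl
          rw [dif_pos ha] at this
          split_ifs at this with h
          simpa using this
        · rintro rfl
          rw [dif_pos ha] at this
          split_ifs at this with h
          simpa using this.symm
      rintro (⟨a, ha⟩ | ⟨s, hs1⟩) (⟨b, hb⟩ | ⟨t, ht⟩)
      · simp
      · simpa using key a ha t ht
      · simp only [Sum.elim_inl, Sum.elim_inr]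
        rw [eq_comm, key b hb s hs1, eq_comm]
      · simp)
  refine ⟨π, fun a ha => hπ (Sum.inl ⟨a, ha⟩), ?_⟩
  -- `ρy⁻¹ * π * ρx` fixes the support of `o`
  have h1 := supports_supp o (ρy⁻¹ * π * ρx) fun s hs' => by
    have := hπ (Sum.inr ⟨s, hs'⟩)
    simp only [Sum.elim_inr] at this
    rw [mul_smul, mul_smul, this, inv_smul_smul]
  rw [mul_smul, mul_smul, inv_smul_eq_iff, hx, hy] at h1
  exact h1

end Orbits

/-! ### Words and their left-open names -/

namespace Letter

variable {𝔸 : Type u}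

@[simp] theorem smul_free (π : FinPerm 𝔸) (a : 𝔸) : π • free a = free (π • a) := rfl
@[simp] theorem smul_alloc (π : FinPerm 𝔸) (a : 𝔸) : π • alloc a = alloc (π • a) := rfl
@[simp] theorem smul_dealloc (π : FinPerm 𝔸) (a : 𝔸) : π • dealloc a = dealloc (π • a) := rfl
@[simp] theorem smul_unknown (π : FinPerm 𝔸) (a : 𝔸) : π • unknown a = unknown (π • a) := rfl

end Letter

namespace DWord

variable {𝔸 : Type u}

@[simp] theorem smul_nil (π : FinPerm 𝔸) : π • ([] : DWord 𝔸) = [] := rfl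

@[simp] theorem smul_cons (π : FinPerm 𝔸) (γ : Letter 𝔸) (w : DWord 𝔸) :
    π • (γ :: w : DWord 𝔸) = (π • γ) :: (π • w) := rfl

theorem isNominal : IsNominal 𝔸 (DWord 𝔸) := by
  intro w
  induction w with
  | nil => exact ⟨∅, Set.finite_empty, fun _ _ => rfl⟩
  | cons γ w ih =>
    obtain ⟨S, hS, h⟩ := ih
    refine ⟨insert γ.name S, hS.insert _, fun π hπ => ?_⟩
    have h1 : π • γ = γ := by
      have := hπ (Set.mem_insert _ _)
      cases γ <;> simpa [Letter.name] using this
    rw [smul_cons, h1, h π fun a ha => hπ (Set.mem_insert_of_mem _ ha)]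

@[simp] theorem lo_nil : lo ([] : DWord 𝔸) = ∅ := rfl
@[simp] theorem lo_free (a : 𝔸) (w : DWord 𝔸) : lo (.free a :: w) = lo w ∪ {a} := rfl
@[simp] theorem lo_alloc (a : 𝔸) (w : DWord 𝔸) : lo (.alloc a :: w) = lo w \ {a} := rfl
@[simp] theorem lo_dealloc (a : 𝔸) (w : DWord 𝔸) : lo (.dealloc a :: w) = lo w ∪ {a} := rfl
@[simp] theorem lo_unknown (a : 𝔸) (w : DWord 𝔸) : lo (.unknown a :: w) = lo w \ {a} := rfl

theorem finite_lo (w : DWord 𝔸) : (lo w).Finite := by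
  induction w with
  | nil => exact Set.finite_empty
  | cons γ w ih =>
    cases γ
    · exact ih.union (Set.finite_singleton _)
    · exact ih.sdiff
    · exact ih.union (Set.finite_singleton _)
    · exact ih.sdiff

@[simp] theorem smul_mem_lo_iff {π : FinPerm 𝔸} {a : 𝔸} {w : DWord 𝔸} :
    π • a ∈ lo (π • w) ↔ a ∈ lo w := by
  induction w with
  | nil => simp
  | cons γ w ih => cases γ <;> simp [ih]

theorem mem_lo_swap_iff {a b c : 𝔸} {w : DWord 𝔸} :
    c ∈ lo (swap a b • w) ↔ swap a b • c ∈ lo w := by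
  rw [← smul_mem_lo_iff (π := swap a b) (w := w), swap_smul_swap_smul]

theorem lo_subset_supp [Infinite 𝔸] (w : DWord 𝔸) : lo w ⊆ supp 𝔸 w :=
  subset_supp_of_equivariant lo (fun _ _ _ => smul_mem_lo_iff.2) (finite_lo w)

/-! ### Right-non-shadowing words -/

theorem mem_lo_append {x y : DWord 𝔸} {a : 𝔸} (hy : a ∈ lo y) (hx : a ∉ lc x) :
    a ∈ lo (x ++ y) := by
  induction x with
  | nil => exact hy
  | cons γ x ih =>
    cases γ with
    | free b | dealloc b =>
      by_cases hab : a = b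
      · exact Or.inr hab
      · exact Or.inl (ih fun h => hx ⟨h, hab⟩)
    | alloc b | unknown b => exact ⟨ih fun h => hx (Or.inl h), fun h => hx (Or.inr h)⟩

theorem rc_subset_rc_cons (γ : Letter 𝔸) (x : DWord 𝔸) : rc x ⊆ rc (γ :: x) := by
  cases γ
  · exact subset_rfl
  · exact subset_rfl
  · exact Set.subset_union_left
  · exact Set.subset_union_left

theorem RNS.tail {γ : Letter 𝔸} {w : DWord 𝔸} (h : RNS (γ :: w)) : RNS w := by
  rintro x y rfl
  refine Set.subset_eq_empty ?_ (h (γ :: x) y rfl)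
  exact Set.inter_subset_inter_left _ (rc_subset_rc_cons γ x)

theorem rns_nil : RNS ([] : DWord 𝔸) := by
  intro x y h
  obtain ⟨rfl, rfl⟩ := List.append_eq_nil_iff.1 h.symm
  simp [rc]

/-- Prefixing a letter preserves right-non-shadowing if the letter either closes a name that is not
left-open in the word, or closes nothing. -/
theorem RNS.cons {γ : Letter 𝔸} {w : DWord 𝔸} (h : RNS w)
    (hγ : ∀ x : DWord 𝔸, rc (γ :: x) ⊆ rc x ∪ ({γ.name} \ (lc x ∪ lo x)) ∧ γ.name ∉ lo w ∨
      rc (γ :: x) = rc x) : RNS (γ :: w) := by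
  intro x y hxy
  cases x with
  | nil => simp [rc]
  | cons δ x =>
    obtain ⟨rfl, rfl⟩ := List.cons_eq_cons.1 hxy
    have h1 := h x y rfl
    rcases hγ x with ⟨h2, h3⟩ | h2
    · rw [Set.eq_empty_iff_forall_notMem] at h1 ⊢
      rintro a ⟨ha, hay⟩
      rcases h2 ha with ha | ⟨rfl, ha⟩
      · exact h1 a ⟨ha, hay⟩
      · exact h3 (mem_lo_append hay fun h => ha (Or.inl h))
    · rwa [h2]

@[simp] theorem rns_free_iff {a : 𝔸} {w : DWord 𝔸} : RNS (.free a :: w) ↔ RNS w :=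
  ⟨RNS.tail, fun h => h.cons fun _ => Or.inr rfl⟩

@[simp] theorem rns_alloc_iff {a : 𝔸} {w : DWord 𝔸} : RNS (.alloc a :: w) ↔ RNS w :=
  ⟨RNS.tail, fun h => h.cons fun _ => Or.inr rfl⟩

@[simp] theorem rns_dealloc_iff {a : 𝔸} {w : DWord 𝔸} :
    RNS (.dealloc a :: w) ↔ RNS w ∧ a ∉ lo w := by
  refine ⟨fun h => ⟨h.tail, fun ha => ?_⟩, fun h => h.1.cons fun _ => Or.inl ⟨subset_rfl, h.2⟩⟩
  have := h [.dealloc a] w rfl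
  rw [Set.eq_empty_iff_forall_notMem] at this
  exact this a ⟨by simp [rc, lc], ha⟩

@[simp] theorem rns_unknown_iff {a : 𝔸} {w : DWord 𝔸} :
    RNS (.unknown a :: w) ↔ RNS w ∧ a ∉ lo w := by
  refine ⟨fun h => ⟨h.tail, fun ha => ?_⟩, fun h => h.1.cons fun _ => Or.inl ⟨subset_rfl, h.2⟩⟩
  have := h [.unknown a] w rfl
  rw [Set.eq_empty_iff_forall_notMem] at this
  exact this a ⟨by simp [rc, lc], ha⟩

theorem RNS.smul {w : DWord 𝔸} (h : RNS w) (π : FinPerm 𝔸) : RNS (π • w) := by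
  induction w with
  | nil => exact rns_nil
  | cons γ w ih => cases γ <;> simp_all

/-! ### `α`-equivalence -/

theorem RNS.alphaEquiv_refl {w : DWord 𝔸} (h : RNS w) : AlphaEquiv w w := by
  induction w with
  | nil => exact .nil
  | cons γ w ih =>
    cases γ with
    | free a => exact .congr_free _ _ _ (ih h.tail)
    | alloc a => exact .congr_alloc _ _ _ (ih h.tail)
    | dealloc a => exact .congr_dealloc _ _ _ (ih h.tail) (rns_dealloc_iff.1 h).2
    | unknown a =>
      exact .congr_unknown _ _ _ _ (ih h.tail) (by simpa using (rns_unknown_iff.1 h).2)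

theorem pair_inter_lo_eq_empty_iff {a b : 𝔸} {w : DWord 𝔸} :
    {a, b} ∩ lo w = ∅ ↔ a ∉ lo w ∧ b ∉ lo w := by
  rw [Set.eq_empty_iff_forall_notMem]
  simp

variable [Infinite 𝔸]

theorem lo_diff_swap {a b : 𝔸} {w : DWord 𝔸} (h : b = a ∨ b ∉ supp 𝔸 w) :
    lo (swap a b • w) \ {b} = lo w \ {a} := by
  rcases eq_or_ne b a with rfl | hba
  · simp
  have hb : b ∉ lo w := fun hb => h.resolve_left hba (lo_subset_supp w hb)
  ext c
  simp only [Set.mem_sdiff, mem_lo_swap_iff, Set.mem_singleton_iff]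
  rcases eq_or_ne c b with rfl | hcb
  · simpa using fun h => absurd h hb
  rcases eq_or_ne c a with rfl | hca
  · simpa using fun h => absurd h hb
  · simp [swap_smul_of_ne hca hcb, hcb, hca]

theorem AlphaEquiv.lo_eq {w w' : DWord 𝔸} (h : AlphaEquiv w w') : lo w = lo w' := by
  induction h with
  | nil => rfl
  | bind a b w w' _ _ h =>
    obtain ⟨rfl, hb⟩ := (abst_eq_iff isNominal).1 h
    exact (lo_diff_swap hb).symm
  | congr_free a w w' _ ih => simp [ih]
  | congr_alloc a w w' _ ih => simp [ih]
  | congr_dealloc a w w' _ _ ih => simp [ih]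
  | congr_unknown a b w w' _ h ih =>
    rw [pair_inter_lo_eq_empty_iff] at h
    rw [lo_unknown, lo_unknown, ← ih, Set.sdiff_singleton_eq_self h.1,
      Set.sdiff_singleton_eq_self h.2]
  | trans _ _ _ _ _ ih₁ ih₂ => exact ih₁.trans ih₂

theorem AlphaEquiv.symm {w w' : DWord 𝔸} (h : AlphaEquiv w w') : AlphaEquiv w' w := by
  induction h with
  | nil => exact .nil
  | bind a b w w' h₁ h₂ h => exact .bind _ _ _ _ h₂ h₁ h.symm
  | congr_free a w w' _ ih => exact .congr_free _ _ _ ih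
  | congr_alloc a w w' _ ih => exact .congr_alloc _ _ _ ih
  | congr_dealloc a w w' h₁ h₂ ih => exact .congr_dealloc _ _ _ ih (h₁.lo_eq ▸ h₂)
  | congr_unknown a b w w' h₁ h₂ ih =>
    exact .congr_unknown _ _ _ _ ih (by rwa [Set.pair_comm, ← h₁.lo_eq])
  | trans _ _ _ _ _ ih₁ ih₂ => exact ih₂.trans _ _ _ ih₁

theorem AlphaEquiv.alphaClass_eq {w w' : DWord 𝔸} (h : AlphaEquiv w w') :
    alphaClass w = alphaClass w' :=
  Set.ext fun _ => ⟨h.symm.trans _ _ _, h.trans _ _ _⟩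

theorem alphaEquiv_alloc_swap {a b : 𝔸} {w : DWord 𝔸} (hw : RNS w) (h : b = a ∨ b ∉ supp 𝔸 w) :
    AlphaEquiv (.alloc a :: w) (.alloc b :: swap a b • w) :=
  .bind _ _ _ _ (rns_alloc_iff.2 hw) (rns_alloc_iff.2 (hw.smul _))
    ((abst_eq_iff isNominal).2 ⟨rfl, h⟩)

theorem AlphaEquiv.smul {w w' : DWord 𝔸} (h : AlphaEquiv w w') (π : FinPerm 𝔸) :
    AlphaEquiv (π • w) (π • w') := by
  induction h with
  | nil => exact .nil
  | bind a b w w' h₁ h₂ h =>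
    obtain ⟨rfl, hb⟩ := (abst_eq_iff isNominal).1 h
    rw [smul_cons, smul_cons, smul_swap_smul]
    refine alphaEquiv_alloc_swap (h₁.tail.smul π) ?_
    rwa [smul_mem_supp_iff, smul_left_cancel_iff]
  | congr_free a w w' _ ih => exact .congr_free _ _ _ ih
  | congr_alloc a w w' _ ih => exact .congr_alloc _ _ _ ih
  | congr_dealloc a w w' h₁ h₂ ih => exact .congr_dealloc _ _ _ ih (smul_mem_lo_iff.not.2 h₂)
  | congr_unknown a b w w' h₁ h₂ ih =>
    refine .congr_unknown _ _ _ _ ih ?_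
    rw [pair_inter_lo_eq_empty_iff] at h₂ ⊢
    exact ⟨smul_mem_lo_iff.not.2 h₂.1, smul_mem_lo_iff.not.2 h₂.2⟩
  | trans _ _ _ _ _ ih₁ ih₂ => exact ih₁.trans _ _ _ ih₂

/-- Up to `α`-equivalence, a right-non-shadowing word depends only on its left-open names:
permutations fixing these do not change its class. An allocated name is first renamed to a globally
fresh one, so that the permutation may be corrected to fix it. -/
theorem RNS.alphaEquiv_smul {w : DWord 𝔸} (hw : RNS w) {π : FinPerm 𝔸}
    (hπ : ∀ a ∈ lo w, π • a = a) : AlphaEquiv w (π • w) := by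
  induction hn : w.length generalizing w π with
  | zero =>
    obtain rfl := List.length_eq_zero_iff.1 hn
    exact .nil
  | succ n ih =>
    obtain ⟨γ, w, rfl⟩ := List.exists_cons_of_length_eq_add_one hn
    replace hn : w.length = n := by simpa using hn
    cases γ with
    | free a =>
      rw [smul_cons, Letter.smul_free, hπ a (Or.inr rfl)]
      exact .congr_free _ _ _ (ih hw.tail (fun b hb => hπ b (Or.inl hb)) hn)
    | dealloc a =>
      rw [smul_cons, Letter.smul_dealloc, hπ a (Or.inr rfl)]
      exact .congr_dealloc _ _ _ (ih hw.tail (fun b hb => hπ b (Or.inl hb)) hn)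
        (rns_dealloc_iff.1 hw).2
    | unknown a =>
      have ha := (rns_unknown_iff.1 hw).2
      rw [lo_unknown, Set.sdiff_singleton_eq_self ha] at hπ
      refine .congr_unknown _ _ _ _ (ih hw.tail hπ hn) (pair_inter_lo_eq_empty_iff.2 ⟨ha, ?_⟩)
      intro h
      have h' : π • a = a := smul_left_cancel π (hπ _ h)
      exact ha (h' ▸ h)
    | alloc a =>
      obtain ⟨c, hc⟩ := exists_fresh
        ((isNominal.finite_supp w).union (isNominal.finite_supp (π • w)))
      rw [Set.mem_union, not_or] at hc
      have h1 := alphaEquiv_alloc_swap (a := a) hw.tail (Or.inr hc.1)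
      have h2 := alphaEquiv_alloc_swap (a := π • a) (hw.tail.smul π) (Or.inr hc.2)
      have h3 := ih (hw.tail.smul (swap a c)) (π := swap (π • a) c * π * swap a c) (by
        intro d hd
        rw [mem_lo_swap_iff] at hd
        rcases eq_or_ne d c with rfl | hdc
        · simp [mul_smul]
        rcases eq_or_ne d a with rfl | hda
        · rw [swap_smul_left] at hd
          exact absurd (lo_subset_supp w hd) hc.1
        rw [swap_smul_of_ne hda hdc] at hd
        rw [mul_smul, mul_smul, swap_smul_of_ne hda hdc]
        have hd' := hπ d ⟨hd, hda⟩
        rw [hd', swap_smul_of_ne ?_ hdc]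
        intro h
        rw [← hd'] at h
        exact hda (smul_left_cancel π h)) (by
          change List.length (List.map _ _) = n
          simpa using hn)
      rw [mul_smul, mul_smul, swap_smul_swap_smul] at h3
      exact (h1.trans _ _ _ (.congr_alloc _ _ _ h3)).trans _ _ _ h2.symm

end DWord

/-! ### Adding and removing deallocation markers -/

variable {𝔸 : Type u}

/-- Removal of the deallocation marker of a letter. -/
def Letter.dropClose : Letter 𝔸 → Letter 𝔸
  | free a => free a
  | alloc a => alloc a
  | dealloc a => free a
  | unknown a => alloc a

namespace DWord

/-- Removal of all deallocation markers of a word. -/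
def dropClose (w : DWord 𝔸) : DWord 𝔸 := w.map Letter.dropClose

open Classical in
/-- The word obtained by placing the deallocation markers exactly at those letters whose name is
not left-open in the rest of the word, that is, at the last occurrences of names before they are
allocated again or the word ends. Markers already present are ignored. -/
noncomputable def markClose : DWord 𝔸 → DWord 𝔸
  | [] => []
  | .free a :: w => (if a ∈ lo w then .free a else .dealloc a) :: markClose w
  | .alloc a :: w => (if a ∈ lo w then .alloc a else .unknown a) :: markClose w
  | .dealloc a :: w => (if a ∈ lo w then .free a else .dealloc a) :: markClose w
  | .unknown a :: w => (if a ∈ lo w then .alloc a else .unknown a) :: markClose w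

@[simp] theorem dropClose_cons (γ : Letter 𝔸) (w : DWord 𝔸) :
    dropClose (γ :: w) = γ.dropClose :: dropClose w := rfl

@[simp] theorem lo_dropClose (w : DWord 𝔸) : lo (dropClose w) = lo w := by
  induction w with
  | nil => rfl
  | cons γ w ih => cases γ <;> simp [Letter.dropClose, ih]

theorem rns_dropClose (w : DWord 𝔸) : RNS (dropClose w) := by
  induction w with
  | nil => exact rns_nil
  | cons γ w ih => cases γ <;> simp [Letter.dropClose, ih]

theorem db_dropClose (w : DWord 𝔸) : db (dropClose w) = db w := by
  induction w with
  | nil => rfl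
  | cons γ w ih =>
    refine List.cons_eq_cons.2 ⟨?_, ih⟩
    cases γ <;> rfl

theorem db_markClose (w : DWord 𝔸) : db (markClose w) = db w := by
  induction w with
  | nil => rfl
  | cons γ w ih =>
    cases γ <;> refine List.cons_eq_cons.2 ⟨?_, ih⟩ <;> split_ifs <;> rfl

@[simp] theorem lo_markClose (w : DWord 𝔸) : lo (markClose w) = lo w := by
  induction w with
  | nil => rfl
  | cons γ w ih => cases γ <;> simp only [markClose] <;> split_ifs <;> simp [ih]

theorem rns_markClose (w : DWord 𝔸) : RNS (markClose w) := by
  induction w with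
  | nil => exact rns_nil
  | cons γ w ih => cases γ <;> simp only [markClose] <;> split_ifs <;> simp [*]

theorem smul_markClose (π : FinPerm 𝔸) (w : DWord 𝔸) :
    π • markClose w = markClose (π • w) := by
  induction w with
  | nil => rfl
  | cons γ w ih =>
    cases γ with
    | free a | alloc a | dealloc a | unknown a =>
      by_cases ha : a ∈ lo w
      · have ha' : π • a ∈ lo (π • w) := smul_mem_lo_iff.2 ha
        simp [markClose, ih, ha, ha']
      · have ha' : π • a ∉ lo (π • w) := smul_mem_lo_iff.not.2 ha
        simp [markClose, ih, ha, ha']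

theorem supp_markClose_subset [Infinite 𝔸] (w : DWord 𝔸) : supp 𝔸 (markClose w) ⊆ supp 𝔸 w :=
  supp_subset (isNominal.finite_supp w) fun π hπ => by
    rw [smul_markClose, supports_supp w π hπ]

theorem AlphaEquiv.markClose [Infinite 𝔸] {w w' : DWord 𝔸} (h : AlphaEquiv w w') :
    AlphaEquiv (markClose w) (markClose w') := by
  induction h with
  | nil => exact .nil
  | bind a b w w' _ _ h =>
    obtain ⟨rfl, hab⟩ := (abst_eq_iff isNominal).1 h
    have hb : b ∈ lo (swap a b • w) ↔ a ∈ lo w := by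
      rw [mem_lo_swap_iff, swap_smul_right]
    by_cases ha : a ∈ lo w
    · rw [DWord.markClose, DWord.markClose, if_pos ha, if_pos (hb.2 ha), ← smul_markClose]
      exact alphaEquiv_alloc_swap (rns_markClose w) (hab.imp_right fun h h' =>
        h (supp_markClose_subset w h'))
    · rw [DWord.markClose, DWord.markClose, if_neg ha, if_neg (hb.not.2 ha), ← smul_markClose]
      have hb : b ∉ lo w := by
        rcases hab with rfl | hab
        · exact ha
        · exact fun h' => hab (lo_subset_supp w h')
      -- neither `a` nor `b` is left-open, so the transposition does not change the class
      refine .congr_unknown _ _ _ _ ((rns_markClose w).alphaEquiv_smul fun c hc => ?_)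
        (pair_inter_lo_eq_empty_iff.2 (by rw [lo_markClose]; exact ⟨ha, hb⟩))
      rw [lo_markClose] at hc
      exact swap_smul_of_ne (by rintro rfl; exact ha hc) (by rintro rfl; exact hb hc)
  | congr_free a w w' h ih | congr_dealloc a w w' h _ ih =>
    by_cases ha : a ∈ lo w
    · rw [DWord.markClose, DWord.markClose, if_pos ha, if_pos (h.lo_eq ▸ ha)]
      exact .congr_free _ _ _ ih
    · rw [DWord.markClose, DWord.markClose, if_neg ha, if_neg (h.lo_eq ▸ ha)]
      exact .congr_dealloc _ _ _ ih (by rwa [lo_markClose])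
  | congr_alloc a w w' h ih =>
    by_cases ha : a ∈ lo w
    · rw [DWord.markClose, DWord.markClose, if_pos ha, if_pos (h.lo_eq ▸ ha)]
      exact .congr_alloc _ _ _ ih
    · rw [DWord.markClose, DWord.markClose, if_neg ha, if_neg (h.lo_eq ▸ ha)]
      exact .congr_unknown _ _ _ _ ih
        (pair_inter_lo_eq_empty_iff.2 (by rw [lo_markClose]; exact ⟨ha, ha⟩))
  | congr_unknown a b w w' h hab ih =>
    rw [pair_inter_lo_eq_empty_iff] at hab
    rw [DWord.markClose, DWord.markClose, if_neg hab.1, if_neg (h.lo_eq ▸ hab.2)]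
    exact .congr_unknown _ _ _ _ ih
      (pair_inter_lo_eq_empty_iff.2 (by rwa [lo_markClose]))
  | trans _ _ _ _ _ ih₁ ih₂ => exact ih₁.trans _ _ _ ih₂

end DWord

/-! ### Names read and stored along transitions -/

namespace NDA

variable {𝔸 : Type u}

theorem Accepts.smul {A : NDA.{u, v} 𝔸} {q : A.State} {w : DWord 𝔸} (h : A.Accepts q w)
    (π : FinPerm 𝔸) : A.Accepts (π • q) (π • w) := by
  induction w generalizing q with
  | nil => exact A.final_equivariant π q h
  | cons γ w ih =>
    obtain ⟨q', h, h'⟩ := h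
    exact ⟨π • q', A.trans_equivariant _ _ _ _ h, ih h'⟩

theorem small_state (A : NDA.{u, v} 𝔸) : Small.{u} A.State := by
  have : Finite (orbitRel.Quotient (FinPerm 𝔸) A.State) := A.orbitFinite
  refine small_of_surjective
    (f := fun p : orbitRel.Quotient (FinPerm 𝔸) A.State × FinPerm 𝔸 => p.2 • p.1.out) fun q => ?_
  obtain ⟨π, hπ⟩ := Quotient.mk_out (s := orbitRel (FinPerm 𝔸) A.State) q
  refine ⟨(Quotient.mk _ q, π⁻¹), ?_⟩
  exact inv_smul_eq_iff.2 hπ.symm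

variable [Infinite 𝔸]

theorem mem_supp_of_trans_free {A : NDA.{u, v} 𝔸} {q q' : A.State} {a : 𝔸}
    (h : A.trans q (.free a) q') : a ∈ supp 𝔸 q := by
  by_contra ha
  refine Set.infinite_of_injOn_mapsTo (f := fun c => (c, swap a c • q')) (s := (supp 𝔸 q)ᶜ)
    (fun c _ d _ hcd => congrArg Prod.fst hcd) (fun c hc => ?_)
    (A.nominal.finite_supp q).infinite_compl (A.finite_free q)
  have := A.trans_equivariant (swap a c) _ _ _ h
  rwa [swap_smul_of_notMem_supp ha hc, Letter.smul_free, swap_smul_left] at this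

theorem supp_subset_of_trans_free {A : NDA.{u, v} 𝔸} {q q' : A.State} {a : 𝔸}
    (h : A.trans q (.free a) q') : supp 𝔸 q' ⊆ supp 𝔸 q := by
  intro d hd
  by_contra hdq
  have ha := mem_supp_of_trans_free h
  refine Set.infinite_of_injOn_mapsTo (f := fun c => (a, swap d c • q'))
    (s := (supp 𝔸 q ∪ supp 𝔸 q')ᶜ) (fun c hc c' hc' hcc' => ?_) (fun c hc => ?_)
    ((A.nominal.finite_supp q).union (A.nominal.finite_supp q')).infinite_compl (A.finite_free q)
  · exact swap_smul_injOn hd (fun h => hc (Or.inr h)) (fun h => hc' (Or.inr h))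
      (congrArg Prod.snd hcc')
  · have hcq : c ∉ supp 𝔸 q := fun h => hc (Or.inl h)
    have := A.trans_equivariant (swap d c) _ _ _ h
    rwa [swap_smul_of_notMem_supp hdq hcq, Letter.smul_free,
      swap_smul_of_ne (by rintro rfl; exact hdq ha) (by rintro rfl; exact hcq ha)] at this

theorem supp_subset_of_trans_alloc {A : NDA.{u, v} 𝔸} {q q' : A.State} {a : 𝔸}
    (h : A.trans q (.alloc a) q') : supp 𝔸 q' \ {a} ⊆ supp 𝔸 q := by
  rintro d ⟨hd, hda⟩
  by_contra hdq
  refine Set.infinite_of_injOn_mapsTo (f := fun c => abst a (swap d c • q'))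
    (s := (supp 𝔸 q ∪ supp 𝔸 q' ∪ {a})ᶜ) (fun c hc c' hc' hcc' => ?_) (fun c hc => ?_)
    (((A.nominal.finite_supp q).union (A.nominal.finite_supp q')).union
      (Set.finite_singleton a)).infinite_compl (A.finite_alloc q)
  · exact swap_smul_injOn hd (fun h => hc (Or.inl (Or.inr h))) (fun h => hc' (Or.inl (Or.inr h)))
      (abst_injective A.nominal hcc')
  · have hcq : c ∉ supp 𝔸 q := fun h => hc (Or.inl (Or.inl h))
    have := A.trans_equivariant (swap d c) _ _ _ h
    rw [swap_smul_of_notMem_supp hdq hcq, Letter.smul_alloc,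
      swap_smul_of_ne (Ne.symm hda) (by rintro rfl; exact hc (Or.inr rfl))] at this
    exact ⟨a, _, this, rfl⟩

theorem IsRNNA.lo_subset_supp {A : NDA.{u, v} 𝔸} (hA : A.IsRNNA) {q : A.State} {w : DWord 𝔸}
    (h : A.Accepts q w) : DWord.lo w ⊆ supp 𝔸 q := by
  induction w generalizing q with
  | nil => exact Set.empty_subset _
  | cons γ w ih =>
    obtain ⟨q', h, h'⟩ := h
    cases γ with
    | free a =>
      exact Set.union_subset ((ih h').trans (supp_subset_of_trans_free h))
        (Set.singleton_subset_iff.2 (mem_supp_of_trans_free h))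
    | alloc a =>
      exact (Set.sdiff_subset_sdiff_left (ih h')).trans (supp_subset_of_trans_alloc h)
    | dealloc a => exact absurd h (hA _ _ _).1
    | unknown a => exact absurd h (hA _ _ _).2

/-! ### The power set construction with live names -/

/-- A state of the power set construction on `A`: a set `live` of at most `k` names, those which
are stored and will be read again, together with a set of states of `A` in which all names other
than the live ones are forgotten, that is, a set closed under the permutations fixing the live
names. The states of `A` are taken in `Shrink`, to lie in the universe of the names. -/
@[ext]
structure LiveSet {𝔸 : Type u} (A : NDA.{u, v} 𝔸) [Small.{u} A.State] (k : ℕ) : Type u where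
  live : Set 𝔸
  states : Set (Shrink.{u} A.State)
  finite_live : live.Finite
  ncard_live : live.ncard ≤ k
  smul_mem : ∀ π : FinPerm 𝔸, (∀ a ∈ live, π • a = a) → ∀ q ∈ states, π • q ∈ states

end NDA

namespace Letter

variable {𝔸 : Type u}

/-- Whether a letter may be read while `L` is the set of live names: stored names must be live, and
newly allocated names must not be. -/
def Enabled (L : Set 𝔸) : Letter 𝔸 → Prop
  | free a => a ∈ L
  | alloc a => a ∉ L
  | dealloc a => a ∈ L
  | unknown a => a ∉ L

/-- The set of live names after reading a letter. -/
def nextLive (L : Set 𝔸) : Letter 𝔸 → Set 𝔸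
  | free _ => L
  | alloc a => insert a L
  | dealloc a => L \ {a}
  | unknown _ => L

theorem dropClose_smul (π : FinPerm 𝔸) (γ : Letter 𝔸) :
    (π • γ).dropClose = π • γ.dropClose := by
  cases γ <;> rfl

end Letter

namespace NDA.LiveSet

variable {𝔸 : Type u} {A : NDA.{u, v} 𝔸} [Small.{u} A.State] {k : ℕ}

instance : SMul (FinPerm 𝔸) (A.LiveSet k) where
  smul π s :=
    { live := {a | π⁻¹ • a ∈ s.live}
      states := {q | π⁻¹ • q ∈ s.states}
      finite_live := s.finite_live.preimage (MulAction.injective π⁻¹).injOn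
      ncard_live := by
        have : {a | π⁻¹ • a ∈ s.live} = (π • ·) '' s.live := by
          ext a
          exact ⟨fun h => ⟨_, h, smul_inv_smul π a⟩, by rintro ⟨b, hb, rfl⟩; simpa using hb⟩
        rw [this, Set.ncard_image_of_injective _ (MulAction.injective π)]
        exact s.ncard_live
      smul_mem := fun ρ hρ q hq => by
        have := s.smul_mem (π⁻¹ * ρ * π) (fun a ha => by
          rw [mul_smul, mul_smul, hρ (π • a) (by simpa using ha), inv_smul_smul]) _ hq
        simpa [mul_smul] using this }

theorem mem_live_smul {π : FinPerm 𝔸} {s : A.LiveSet k} {a : 𝔸} :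
    a ∈ (π • s).live ↔ π⁻¹ • a ∈ s.live := Iff.rfl

theorem mem_states_smul {π : FinPerm 𝔸} {s : A.LiveSet k} {q : Shrink.{u} A.State} :
    q ∈ (π • s).states ↔ π⁻¹ • q ∈ s.states := Iff.rfl

@[simp] theorem smul_mem_live_smul {π : FinPerm 𝔸} {s : A.LiveSet k} {a : 𝔸} :
    π • a ∈ (π • s).live ↔ a ∈ s.live := by
  rw [mem_live_smul, inv_smul_smul]

@[simp] theorem smul_mem_states_smul {π : FinPerm 𝔸} {s : A.LiveSet k} {q : Shrink.{u} A.State} :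
    π • q ∈ (π • s).states ↔ q ∈ s.states := by
  rw [mem_states_smul, inv_smul_smul]

instance : MulAction (FinPerm 𝔸) (A.LiveSet k) where
  one_smul s := by
    refine LiveSet.ext ?_ ?_ <;> ext <;> simp [mem_live_smul, mem_states_smul]
  mul_smul π ρ s := by
    refine LiveSet.ext ?_ ?_ <;> ext <;> simp [mem_live_smul, mem_states_smul, mul_smul]

/-- The states of `A` that are reached from `s` by reading `γ` without its deallocation marker,
after which all names outside `L` are forgotten. -/
def post (s : A.LiveSet k) (γ : Letter 𝔸) (L : Set 𝔸) : Set (Shrink.{u} A.State) :=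
  {q' | ∃ π : FinPerm 𝔸, (∀ a ∈ L, π • a = a) ∧ ∃ q ∈ s.states,
    A.trans ((equivShrink A.State).symm q) γ.dropClose ((equivShrink A.State).symm (π • q'))}

/-- The transitions of the power set construction. -/
def Step (s : A.LiveSet k) (γ : Letter 𝔸) (s' : A.LiveSet k) : Prop :=
  γ.Enabled s.live ∧ s'.live = γ.nextLive s.live ∧ s'.states = s.post γ s'.live

theorem smul_mem_post {s s' : A.LiveSet k} {γ : Letter 𝔸} (π : FinPerm 𝔸)
    {q : Shrink.{u} A.State} (h : q ∈ s.post γ s'.live) :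
    π • q ∈ (π • s).post (π • γ) (π • s').live := by
  obtain ⟨ρ, hρ, p, hp, h⟩ := h
  refine ⟨π * ρ * π⁻¹, fun a ha => ?_, π • p, smul_mem_states_smul.2 hp, ?_⟩
  · rw [mul_smul, mul_smul, hρ _ ha, smul_inv_smul]
  · have := A.trans_equivariant π _ _ _ h
    rw [mul_smul, mul_smul, inv_smul_smul, Letter.dropClose_smul, equivShrink_symm_smul π,
      equivShrink_symm_smul π]
    exact this

theorem Step.smul {s s' : A.LiveSet k} {γ : Letter 𝔸} (h : s.Step γ s') (π : FinPerm 𝔸) :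
    (π • s).Step (π • γ) (π • s') := by
  obtain ⟨h1, h2, h3⟩ := h
  refine ⟨?_, ?_, ?_⟩
  · cases γ <;> simpa [Letter.Enabled] using h1
  · ext a
    obtain ⟨b, rfl⟩ := MulAction.surjective π a
    rw [smul_mem_live_smul, h2]
    cases γ <;> simp [Letter.nextLive]
  · ext q
    rw [mem_states_smul, h3]
    refine ⟨fun h => by simpa using smul_mem_post π h, fun h => ?_⟩
    simpa using smul_mem_post π⁻¹ h

theorem Step.unique {s s₁ s₂ : A.LiveSet k} {γ : Letter 𝔸} (h₁ : s.Step γ s₁)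
    (h₂ : s.Step γ s₂) : s₁ = s₂ := by
  have h : s₁.live = s₂.live := h₁.2.1.trans h₂.2.1.symm
  exact LiveSet.ext h (by rw [h₁.2.2, h₂.2.2, h])

theorem exists_step {s : A.LiveSet k} {γ : Letter 𝔸} (h : γ.Enabled s.live)
    (hk : (γ.nextLive s.live).ncard ≤ k) {q q' : Shrink.{u} A.State} (hq : q ∈ s.states)
    (ht : A.trans ((equivShrink A.State).symm q) γ.dropClose ((equivShrink A.State).symm q')) :
    ∃ s', s.Step γ s' ∧ q' ∈ s'.states := by
  have hfin : (γ.nextLive s.live).Finite := by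
    cases γ
    · exact s.finite_live
    · exact s.finite_live.insert _
    · exact s.finite_live.sdiff
    · exact s.finite_live
  refine ⟨⟨γ.nextLive s.live, s.post γ (γ.nextLive s.live), hfin, hk, ?_⟩, ⟨h, rfl, rfl⟩,
    1, by simp, q, hq, by rwa [one_smul]⟩
  rintro π hπ p ⟨ρ, hρ, h⟩
  refine ⟨ρ * π⁻¹, fun a ha => ?_, by rwa [mul_smul, inv_smul_smul]⟩
  rw [mul_smul, inv_smul_eq_iff.2 (hπ a ha).symm, hρ a ha]

theorem supports_live (s : A.LiveSet k) : Supports (FinPerm 𝔸) s.live s := by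
  intro π hπ
  have hπ : ∀ a ∈ s.live, π • a = a := fun a ha => hπ ha
  have hinv : ∀ a ∈ s.live, π⁻¹ • a = a := fun a ha => by rw [inv_smul_eq_iff, hπ a ha]
  refine LiveSet.ext ?_ ?_
  · ext a
    rw [mem_live_smul]
    refine ⟨fun h => ?_, fun h => by rwa [hinv a h]⟩
    have := hπ _ h
    rw [smul_inv_smul] at this
    rwa [this]
  · ext q
    rw [mem_states_smul]
    refine ⟨fun h => ?_, s.smul_mem _ hinv q⟩
    simpa using s.smul_mem π hπ _ h

theorem isNominal : IsNominal 𝔸 (A.LiveSet k) :=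
  fun s => ⟨s.live, s.finite_live, s.supports_live⟩

variable [Infinite 𝔸]

theorem supp_eq (s : A.LiveSet k) : supp 𝔸 s = s.live :=
  (supp_subset s.finite_live s.supports_live).antisymm
    (subset_supp_of_equivariant LiveSet.live (fun _ _ _ => smul_mem_live_smul.2) s.finite_live)

theorem swap_smul_eq {s : A.LiveSet k} {a b : 𝔸} (ha : a ∉ s.live) (hb : b ∉ s.live) :
    swap a b • s = s :=
  swap_smul_of_notMem_supp (s.supp_eq ▸ ha) (s.supp_eq ▸ hb)

theorem finite_of_live_eq {N : Set 𝔸} (hN : N.Finite) : {s : A.LiveSet k | s.live = N}.Finite := by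
  obtain ⟨T, _, t, ht⟩ := exists_finite_classifier A.nominal A.orbitFinite hN
  refine Set.Finite.of_injOn (t := Set.univ)
    (f := fun s : A.LiveSet k => (fun q => t ((equivShrink A.State).symm q)) '' s.states)
    (fun _ _ => Set.mem_univ _) ?_ Set.finite_univ
  have key : ∀ s s' : A.LiveSet k, s'.live = N →
      (fun q => t ((equivShrink A.State).symm q)) '' s.states =
        (fun q => t ((equivShrink A.State).symm q)) '' s'.states → s.states ⊆ s'.states := by
    intro s s' hs' h q hq
    have h1 := Set.mem_image_of_mem (fun q => t ((equivShrink A.State).symm q)) hq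
    rw [h] at h1
    obtain ⟨q', hq', h1⟩ := h1
    obtain ⟨π, hπ, h2⟩ := ht _ _ h1
    rw [← equivShrink_symm_smul] at h2
    rw [← (equivShrink A.State).symm.injective h2]
    exact s'.smul_mem π (by rwa [hs']) q' hq'
  intro s hs s' hs' h
  exact LiveSet.ext (hs.trans hs'.symm)
    ((key s s' hs' h).antisymm (key s' s hs h.symm))

theorem isOrbitFinite : IsOrbitFinite 𝔸 (A.LiveSet k) := by
  -- one set of names of each cardinality `j ≤ k`
  let N : ℕ → Set 𝔸 := fun j => Infinite.natEmbedding 𝔸 '' Set.Iio j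
  have hN : ∀ j, (N j).Finite := fun j => (Set.finite_Iio j).image _
  have hNc : ∀ j, (N j).ncard = j := fun j => by
    rw [Set.ncard_image_of_injective _ (Infinite.natEmbedding 𝔸).injective, Set.ncard_Iio_nat]
  have hfin : (⋃ j ∈ Set.Iic k, {s : A.LiveSet k | s.live = N j}).Finite :=
    (Set.finite_Iic k).biUnion fun j _ => finite_of_live_eq (hN j)
  have := hfin.to_subtype
  refine Finite.of_surjective
    (fun s : (⋃ j ∈ Set.Iic k, {s : A.LiveSet k | s.live = N j} : Set (A.LiveSet k)) =>
      (Quotient.mk (orbitRel (FinPerm 𝔸) (A.LiveSet k)) s.1)) ?_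
  intro o
  induction o using Quotient.inductionOn with
  | h s =>
  have := s.finite_live.to_subtype
  have := (hN s.live.ncard).to_subtype
  let e : s.live ≃ N s.live.ncard := (Finite.card_eq.1 (hNc _).symm).some
  obtain ⟨π, hπ⟩ := exists_smul_eq (fun a : s.live => (a : 𝔸)) (fun a => (e a : 𝔸)) (by
    intro a b
    rw [Subtype.coe_inj, Subtype.coe_inj, e.apply_eq_iff_eq])
  refine ⟨⟨π • s, Set.mem_biUnion (x := s.live.ncard) s.ncard_live ?_⟩,
    Quotient.sound ⟨π, rfl⟩⟩
  ext b
  rw [mem_live_smul]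
  constructor
  · intro h
    have := hπ ⟨_, h⟩
    rw [smul_inv_smul] at this
    rw [this]
    exact (e _).2
  · intro h
    have := hπ (e.symm ⟨b, h⟩)
    rw [e.apply_symm_apply] at this
    rw [inv_smul_eq_iff.2 this.symm]
    exact (e.symm ⟨b, h⟩).2

theorem Step.swap_alloc {s s' : A.LiveSet k} {a b : 𝔸} (h : s.Step (.alloc a) s')
    (hb : b ∉ s.live) : s.Step (.alloc b) (swap a b • s') := by
  have := h.smul (swap a b)
  rwa [swap_smul_eq h.1 hb, Letter.smul_alloc, swap_smul_left] at this

theorem Step.swap_unknown {s s' : A.LiveSet k} {a b : 𝔸} (h : s.Step (.unknown a) s')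
    (hb : b ∉ s.live) : s.Step (.unknown b) (swap a b • s') := by
  have := h.smul (swap a b)
  rwa [swap_smul_eq h.1 hb, Letter.smul_unknown, swap_smul_left] at this

/-- The initial state: no name is live, and the only state of `A` is its initial state. -/
noncomputable def initial (A : NDA.{u, v} 𝔸) [Small.{u} A.State] (k : ℕ)
    (hinit : supp 𝔸 A.init = ∅) : A.LiveSet k where
  live := ∅
  states := {equivShrink A.State A.init}
  finite_live := Set.finite_empty
  ncard_live := by simp
  smul_mem := by
    rintro π - q rfl
    rw [Set.mem_singleton_iff, ← equivShrink_smul, supports_supp A.init π (by simp [hinit])]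

end LiveSet

/-- The power set construction on `A` with at most `k` live names. A run may end only when no name
is live, so that the deallocation markers of an accepted word sit exactly at the last uses of its
names. -/
noncomputable def livePowerset {𝔸 : Type u} [Infinite 𝔸] (A : NDA.{u, v} 𝔸) [Small.{u} A.State] (k : ℕ)
    (hinit : supp 𝔸 A.init = ∅) : NDA.{u, u} 𝔸 where
  State := A.LiveSet k
  nominal := LiveSet.isNominal
  orbitFinite := LiveSet.isOrbitFinite
  trans := LiveSet.Step
  init := LiveSet.initial A k hinit
  final := {s | s.live = ∅ ∧ ∃ q ∈ s.states, (equivShrink A.State).symm q ∈ A.final}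
  trans_equivariant π _ _ _ h := h.smul π
  final_equivariant := by
    rintro π s ⟨h, q, hq, hf⟩
    refine ⟨?_, π • q, LiveSet.smul_mem_states_smul.2 hq, ?_⟩
    · ext a
      rw [LiveSet.mem_live_smul, h]
      simp
    · rw [equivShrink_symm_smul]
      exact A.final_equivariant π _ hf
  left_invariant_alloc := by
    intro s s' s'' a b h hs
    obtain ⟨rfl, hb⟩ := (abst_eq_iff LiveSet.isNominal).1 h
    rcases hb with rfl | hb
    · simpa using hs
    · rw [LiveSet.supp_eq, hs.2.1] at hb
      exact hs.swap_alloc fun h => hb (Or.inr h)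
  left_invariant_unknown := by
    intro s s' s'' a b h hs
    obtain ⟨rfl, hb⟩ := (abst_eq_iff LiveSet.isNominal).1 h
    rcases hb with rfl | hb
    · simpa using hs
    · rw [LiveSet.supp_eq, hs.2.1] at hb
      exact hs.swap_unknown hb
  erasure_dealloc := by
    intro s s' a h
    rw [LiveSet.supp_eq, h.2.1]
    exact fun ha => ha.2 rfl
  erasure_unknown := by
    intro s s' a h
    rw [LiveSet.supp_eq, h.2.1]
    exact h.1
  finite_free s := Set.Finite.of_injOn (f := Prod.fst) (t := s.live) (fun _ h => h.1)
    (by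
      rintro ⟨a, s₁⟩ h₁ ⟨b, s₂⟩ h₂ rfl
      exact Prod.ext rfl (LiveSet.Step.unique h₁ h₂)) s.finite_live
  finite_alloc s := Set.Subsingleton.finite (by
    rintro _ ⟨a, s₁, h₁, rfl⟩ _ ⟨b, s₂, h₂, rfl⟩
    refine (abst_eq_iff LiveSet.isNominal).2 ⟨h₂.unique (h₁.swap_alloc h₂.1), ?_⟩
    rw [LiveSet.supp_eq, h₁.2.1]
    exact (em (b = a)).imp_right fun h h' => h'.elim h h₂.1)
  finite_dealloc s := Set.Finite.of_injOn (f := Prod.fst) (t := s.live) (fun _ h => h.1)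
    (by
      rintro ⟨a, s₁⟩ h₁ ⟨b, s₂⟩ h₂ rfl
      exact Prod.ext rfl (LiveSet.Step.unique h₁ h₂)) s.finite_live
  finite_unknown s := Set.Subsingleton.finite (by
    rintro _ ⟨a, s₁, h₁, rfl⟩ _ ⟨b, s₂, h₂, rfl⟩
    refine (abst_eq_iff LiveSet.isNominal).2 ⟨h₂.unique (h₁.swap_unknown h₂.1), Or.inr ?_⟩
    rw [LiveSet.supp_eq, h₁.2.1]
    exact h₂.1)

/-! ### The language of the power set construction -/

section Language

variable {𝔸 : Type u} [Infinite 𝔸] {A : NDA.{u, v} 𝔸} [Small.{u} A.State] {k : ℕ}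
  {hinit : supp 𝔸 A.init = ∅}

theorem isDDA_livePowerset : (A.livePowerset k hinit).IsDDA :=
  fun _ _ _ _ h₁ h₂ => LiveSet.Step.unique h₁ h₂

theorem lo_eq_live_of_accepts {s : A.LiveSet k} {w : DWord 𝔸}
    (h : (A.livePowerset k hinit).Accepts s w) : DWord.lo w = s.live := by
  induction w generalizing s with
  | nil => exact h.1.symm
  | cons γ w ih =>
    obtain ⟨s', h, h'⟩ := h
    have hw := ih h'
    obtain ⟨h1, h2, -⟩ := h
    rw [h2] at hw
    cases γ with
    | free a =>
      rw [DWord.lo_free, hw]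
      exact Set.union_eq_self_of_subset_right (Set.singleton_subset_iff.2 h1)
    | alloc a =>
      rw [DWord.lo_alloc, hw]
      exact Set.insert_sdiff_self_of_notMem h1
    | dealloc a =>
      rw [DWord.lo_dealloc, hw, Letter.nextLive, Set.sdiff_union_self]
      exact Set.union_eq_self_of_subset_right (Set.singleton_subset_iff.2 h1)
    | unknown a =>
      rw [DWord.lo_unknown, hw]
      exact Set.sdiff_singleton_eq_self h1

theorem rns_of_accepts {s : A.LiveSet k} {w : DWord 𝔸}
    (h : (A.livePowerset k hinit).Accepts s w) : DWord.RNS w := by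
  induction w generalizing s with
  | nil => exact DWord.rns_nil
  | cons γ w ih =>
    obtain ⟨s', h, h'⟩ := h
    have hw := ih h'
    have hlo := (lo_eq_live_of_accepts h').trans h.2.1
    cases γ with
    | free a => simpa using hw
    | alloc a => simpa using hw
    | dealloc a =>
      refine DWord.rns_dealloc_iff.2 ⟨hw, ?_⟩
      rw [hlo]
      exact fun ha => ha.2 rfl
    | unknown a =>
      refine DWord.rns_unknown_iff.2 ⟨hw, ?_⟩
      rw [hlo]
      exact h.1

/-- The literal language is closed under `α`-equivalence. This rests on left `α`-invariance, and on
the support of a state being contained in the set of left-open names of each word it accepts. -/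
theorem Accepts.of_alphaEquiv {s : A.LiveSet k} {w w' : DWord 𝔸}
    (h : (A.livePowerset k hinit).Accepts s w) (hw : DWord.AlphaEquiv w w') :
    (A.livePowerset k hinit).Accepts s w' := by
  induction hw generalizing s with
  | nil => exact h
  | bind a b w w' _ _ hab =>
    obtain ⟨rfl, hb⟩ := (abst_eq_iff DWord.isNominal).1 hab
    obtain ⟨s', h, h'⟩ := h
    refine ⟨swap a b • s', ?_, h'.smul _⟩
    refine (A.livePowerset k hinit).left_invariant_alloc s s' _ a b
      ((abst_eq_iff LiveSet.isNominal).2 ⟨rfl, hb.imp_right fun hb hb' => hb ?_⟩) h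
    have hb' : b ∈ s'.live := LiveSet.supp_eq (A := A) s' ▸ hb'
    rw [← lo_eq_live_of_accepts h'] at hb'
    exact DWord.lo_subset_supp w hb'
  | congr_free a w w' _ ih | congr_alloc a w w' _ ih | congr_dealloc a w w' _ _ ih =>
    obtain ⟨s', h, h'⟩ := h
    exact ⟨s', h, ih h'⟩
  | congr_unknown a b w w' _ hab ih =>
    obtain ⟨s', h, h'⟩ := h
    rw [DWord.pair_inter_lo_eq_empty_iff, lo_eq_live_of_accepts h'] at hab
    have hb := h.swap_unknown (b := b) (fun hb => hab.2 (by rw [h.2.1]; exact hb))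
    rw [LiveSet.swap_smul_eq hab.1 hab.2] at hb
    exact ⟨s', hb, ih h'⟩
  | trans _ _ _ _ _ ih₁ ih₂ => exact ih₂ (ih₁ h)

/-- Soundness: up to `α`-equivalence, words accepted by the power set construction are accepted by
`A` once their deallocation markers are removed. A state of `A` in the successor set is known only
up to a permutation fixing the live names; as these are the left-open names of the remaining word,
the permutation does not change its class. -/
theorem exists_accepts_alphaEquiv_dropClose {s : A.LiveSet k} {w : DWord 𝔸}
    (h : (A.livePowerset k hinit).Accepts s w) :
    ∃ q ∈ s.states, ∃ v, A.Accepts ((equivShrink A.State).symm q) v ∧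
      DWord.AlphaEquiv v (DWord.dropClose w) := by
  induction w generalizing s with
  | nil =>
    obtain ⟨-, q, hq, h⟩ := h
    exact ⟨q, hq, [], h, .nil⟩
  | cons γ w ih =>
    obtain ⟨s', h, h'⟩ := h
    obtain ⟨q', hq', v, hv, hvw⟩ := ih h'
    rw [h.2.2] at hq'
    obtain ⟨π, hπ, q, hq, ht⟩ := hq'
    have hvw : DWord.AlphaEquiv (π • v) (DWord.dropClose w) := by
      refine (hvw.smul π).trans _ _ _
        (((DWord.rns_dropClose w).alphaEquiv_smul fun a ha => hπ a ?_).symm)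
      rwa [DWord.lo_dropClose, lo_eq_live_of_accepts h'] at ha
    refine ⟨q, hq, γ.dropClose :: π • v, ⟨_, ht, ?_⟩, ?_⟩
    · rw [equivShrink_symm_smul]
      exact hv.smul π
    · cases γ with
      | free a | dealloc a => exact .congr_free _ _ _ hvw
      | alloc a | unknown a => exact .congr_alloc _ _ _ hvw

/-- Completeness: a word accepted by `A` is accepted by the power set construction once the
deallocation markers are placed. The live names along the run are the left-open names of the
remaining word; these belong to the support of the current state of `A`, which bounds their
number. -/
theorem accepts_markClose (hA : A.IsRNNA) (hk : ∀ q : A.State, (supp 𝔸 q).ncard ≤ k)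
    {s : A.LiveSet k} {v : DWord 𝔸} {q : Shrink.{u} A.State} (hq : q ∈ s.states)
    (h : A.Accepts ((equivShrink A.State).symm q) v) (hs : s.live = DWord.lo v) :
    (A.livePowerset k hinit).Accepts s (DWord.markClose v) := by
  induction v generalizing s q with
  | nil => exact ⟨hs, q, hq, h⟩
  | cons γ v ih =>
    obtain ⟨q', ht, h'⟩ := h
    obtain ⟨q', rfl⟩ := (equivShrink A.State).symm.surjective q'
    have hcard : (DWord.lo v).ncard ≤ k :=
      (Set.ncard_le_ncard (hA.lo_subset_supp h') (A.nominal.finite_supp _)).trans (hk _)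
    have key : ∀ δ : Letter 𝔸, δ.dropClose = γ → δ.Enabled s.live →
        δ.nextLive s.live = DWord.lo v →
        (A.livePowerset k hinit).Accepts s (δ :: DWord.markClose v) := by
      rintro δ rfl hδ hL
      obtain ⟨s', hs', hq'⟩ := LiveSet.exists_step hδ (hL ▸ hcard) hq ht
      exact ⟨s', hs', ih hq' h' (hs'.2.1.trans hL)⟩
    cases γ with
    | free a =>
      rw [DWord.lo_free] at hs
      rw [DWord.markClose]
      split_ifs with ha
      · exact key _ rfl (by rw [hs]; exact Or.inr rfl)
          (by rw [Letter.nextLive, hs]; simpa using ha)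
      · exact key _ rfl (by rw [hs]; exact Or.inr rfl)
          (by rw [Letter.nextLive, hs, Set.union_sdiff_right, Set.sdiff_singleton_eq_self ha])
    | alloc a =>
      rw [DWord.lo_alloc] at hs
      rw [DWord.markClose]
      split_ifs with ha
      · exact key _ rfl (by rw [hs]; exact fun h => h.2 rfl)
          (by rw [Letter.nextLive, hs]; exact Set.insert_sdiff_self_of_mem ha)
      · exact key _ rfl (by rw [hs]; exact fun h => h.2 rfl)
          (by rw [Letter.nextLive, hs, Set.sdiff_singleton_eq_self ha])
    | dealloc a => exact absurd ht (hA _ _ _).1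
    | unknown a => exact absurd ht (hA _ _ _).2

theorem dataLanguage_livePowerset (hA : A.IsRNNA) (hk : ∀ q : A.State, (supp 𝔸 q).ncard ≤ k) :
    (A.livePowerset k hinit).dataLanguage = localFreshness A.alphaticLanguage := by
  ext d
  constructor
  · rintro ⟨w, hw, rfl⟩
    obtain ⟨q, hq, v, hv, hvw⟩ := exists_accepts_alphaEquiv_dropClose hw
    obtain rfl : q = equivShrink A.State A.init := hq
    rw [Equiv.symm_apply_apply] at hv
    exact ⟨DWord.dropClose w, ⟨DWord.rns_dropClose w, v, hv, hvw.alphaClass_eq⟩,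
      DWord.db_dropClose w⟩
  · rintro ⟨w, ⟨hw, v, hv, hvw⟩, rfl⟩
    have hvw : DWord.AlphaEquiv v w := by
      have : w ∈ DWord.alphaClass w := hw.alphaEquiv_refl
      rwa [← hvw] at this
    have hlo : DWord.lo v = ∅ := by
      have := hA.lo_subset_supp hv
      rwa [hinit, Set.subset_empty_iff] at this
    refine ⟨DWord.markClose w, ?_, DWord.db_markClose w⟩
    refine Accepts.of_alphaEquiv (A := A) (hinit := hinit) ?_ hvw.markClose
    refine accepts_markClose hA hk (q := equivShrink A.State A.init) rfl ?_ hlo.symm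
    rwa [Equiv.symm_apply_apply]

theorem localFreshness_livePowerset :
    localFreshness (A.livePowerset k hinit).alphaticLanguage =
      (A.livePowerset k hinit).dataLanguage := by
  ext d
  constructor
  · rintro ⟨w, ⟨hw, v, hv, hvw⟩, rfl⟩
    have hvw : DWord.AlphaEquiv v w := by
      have : w ∈ DWord.alphaClass w := hw.alphaEquiv_refl
      rwa [← hvw] at this
    exact ⟨w, Accepts.of_alphaEquiv hv hvw, rfl⟩
  · rintro ⟨w, hw, rfl⟩
    exact ⟨w, ⟨rns_of_accepts hw, w, hw, rfl⟩, rfl⟩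

end Language

end NDA
end

theorem mainTheorem11 {𝔸 : Type u} [Countable 𝔸] [Infinite 𝔸]
    (A : NDA.{u, v} 𝔸) (hA : A.IsRNNA) (hinit : supp 𝔸 A.init = ∅) :
    ∃ B : NDA.{u, u} 𝔸, B.IsDDA ∧
      B.dataLanguage = localFreshness A.alphaticLanguage ∧
      localFreshness B.alphaticLanguage = localFreshness A.alphaticLanguage := by
  have := A.small_state
  obtain ⟨k, hk⟩ := exists_ncard_supp_le A.orbitFinite
  have h := NDA.dataLanguage_livePowerset (hinit := hinit) hA hk
  exact ⟨A.livePowerset k hinit, NDA.isDDA_livePowerset, h,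
    NDA.localFreshness_livePowerset.trans h⟩
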